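/- Let $p\ge 3$ be a prime and let $3\le r<s$ be integers with $(r-1)\nmid(s-1)$ and $(r-1)\nmid s$. Write $[x]$ for the integer part of $x$. Let $$A(s,r)=\{(a_1,\dots,a_r)\in\mathbb Z^r:\ 0=a_1<a_2<\dots<a_r=s-1\},\qquad h_p(a)=\sum_{1\le k<i\le r}\frac1{p^{a_i-a_k}} ,$$ and for $a\in A(s,r)$ let $\delta(a)=(a_2-a_1,\dots,a_r-a_{r-1})$ be its delta vector; the inverse map is $\delta^{-1}(d_1,\dots,d_{r-1})=(0,d_1,d_1+d_2,\dots,d_1+\dots+d_{r-1})$. Put $q=\frac{s-1}{r-1}$ and let $g$ be the least positive residue of $s-1$ modulo $r-1$. A $v$-block of a vector is a nonempty maximal run of consecutive entries equal to $v$. Assume that $a\in A(s,r)$ satisfies $h_p(a)=\min\{h_p(b): b\in A(s,r)\}$, and write $d=(d_1,\dots,d_{r-1})=\delta(a)$. If $2g\ge r-1$, put $q_2=\frac{g}{r-g-2}$. Then: (i) If $(r-g-2)\mid g$, then $$a=\delta^{-1}\big([q],\underbrace{[q+1],\dots,[q+1]}_{q_2},[q],\underbrace{[q+1],\dots,[q+1]}_{q_2},[q],\dots,\underbrace{[q+1],\dots,[q+1]}_{q_2},[q]\big).$$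 (ii) If $(r-g-2)\nmid g$, then exactly $r-g-1$ entries of $d$ equal $[q]$, among them $d_1=d_{r-1}=[q]$, and there is no $j$ with $d_j=d_{j+1}=[q]$. The remaining $g$ entries all equal $[q+1]$, and every $[q+1]$-block has length $[q_2]$ or $[q_2+1]$. More precisely, exactly $e$ of the $[q+1]$-blocks have length $[q_2+1]$ and exactly $r-g-2-e$ have length $[q_2]$, where $e$ is the least positive residue of $g$ modulo $r-g-2$. If $2g\le r-2$, put $q_1=\frac{r-g-1}{g+1}$. Then: (iii) If $(g+1)\mid(r-g-1)$, then $$a=\delta^{-1}\big(\underbrace{[q],\dots,[q]}_{q_1},[q+1],\underbrace{[q],\dots,[q]}_{q_1},[q+1],\dots,[q+1],\underbrace{[q],\dots,[q]}_{q_1}\big).$$ (iv) If $(g+1)\nmid(r-g-1)$, then exactly $g$ entries of $d$ equal $[q+1]$, with $d_1\ne[q+1]$ and $d_{r-1}\ne[q+1]$, and there is no $j$ with $d_j=d_{j+1}=[q+1]$. The remaining $r-g-1$ entries all equal $[q]$, and every $[q]$-block has length $[q_1]$ or $[q_1+1]$. More precisely, exactly $f$ of the $[q]$-blocks have length $[q_1+1]$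 and exactly $g+1-f$ have length $[q_1]$, where $f$ is the least positive residue of $r-g-1$ modulo $g+1$. -/

import Mathlib

/-- The set `A(s, r)` of admissible exponent tuples: integer tuples `(a_1, …, a_r)` with
`0 = a_1 < a_2 < … < a_r = s - 1`.  Indices are shifted: `a i` is the entry `a_{i+1}`. -/
def admissible (s r : ℕ) : Set (Fin r → ℤ) :=
  {a | StrictMono a ∧ (∀ i : Fin r, (i : ℕ) = 0 → a i = 0) ∧
    (∀ i : Fin r, (i : ℕ) + 1 = r → a i = (s : ℤ) - 1)}

/-- `h_p(x) = ∑_{k < i} 1 / p ^ (x_i - x_k)` for a real vector `x`. -/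
noncomputable def hp (p : ℕ) {r : ℕ} (x : Fin r → ℝ) : ℝ :=
  ∑ k : Fin r, ∑ i ∈ Finset.Ioi k, 1 / (p : ℝ) ^ (x i - x k)

/-- The admissible tuple `a` satisfies `h_p(a) = min h_p`, the minimum over `A(s, r)`. -/
def IsMinimizer (p s r : ℕ) (a : Fin r → ℤ) : Prop :=
  a ∈ admissible s r ∧
    IsMinOn (fun b : Fin r → ℤ => hp p (fun i => (b i : ℝ))) (admissible s r) a

/-- The delta vector of a tuple: the differences of successive entries. -/
def delta {r : ℕ} (a : Fin r → ℤ) (j : Fin (r - 1)) : ℤ :=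
  a ⟨(j : ℕ) + 1, by have := j.isLt; omega⟩ - a ⟨(j : ℕ), by have := j.isLt; omega⟩

/-- The inverse of `delta`: `(d_1, …, d_{r-1})` is sent to `(0, d_1, d_1 + d_2, …)`. -/
def deltaInv {r : ℕ} (d : Fin (r - 1) → ℤ) (i : Fin r) : ℤ :=
  ∑ j : Fin (r - 1), if (j : ℕ) < (i : ℕ) then d j else 0

/-- The vector `(x, y, …, y, x, y, …, y, x, …)` of length `n`: entries `x` in the positions
`0, t + 1, 2 (t + 1), …`, each followed by `t` entries `y`. -/
def singleFirst (n : ℕ) (x y : ℤ) (t : ℕ) (j : Fin n) : ℤ :=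
  if (j : ℕ) % (t + 1) = 0 then x else y

/-- The vector `(x, …, x, y, x, …, x, y, …)` of length `n`: groups of `t` entries `x`, each
followed by one entry `y`, as far as the length permits. -/
def groupFirst (n : ℕ) (x y : ℤ) (t : ℕ) (j : Fin n) : ℤ :=
  if (j : ℕ) % (t + 1) = t then y else x

/-- A `v`-block of `d` of length `l` starting at position `i`: a nonempty maximal run of
consecutive entries equal to `v`, occupying exactly the positions `i, …, i + l - 1`. -/
def IsBlock {n : ℕ} (d : Fin n → ℤ) (v : ℤ) (i l : ℕ) : Prop :=
  1 ≤ l ∧ i + l ≤ n ∧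
    (∀ j : Fin n, i ≤ (j : ℕ) → (j : ℕ) < i + l → d j = v) ∧
    (∀ j : Fin n, (j : ℕ) + 1 = i → d j ≠ v) ∧
    (∀ j : Fin n, (j : ℕ) = i + l → d j ≠ v)

/-- The number of `v`-blocks of `d` of length `l`. -/
noncomputable def numBlocks {n : ℕ} (d : Fin n → ℤ) (v : ℤ) (l : ℕ) : ℕ :=
  {i : ℕ | IsBlock d v i l}.ncard

/-- The number of entries of `d` equal to `v`. -/
def numEntries {n : ℕ} (d : Fin n → ℤ) (v : ℤ) : ℕ :=
  (Finset.univ.filter fun j => d j = v).card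

/-- `x` is the least positive residue of `b` modulo `m`. -/
def IsLeastPosResidue (m b x : ℕ) : Prop :=
  IsLeast {y : ℕ | 0 < y ∧ y ≡ b [MOD m]} x

/-! Put θ = 1/p ≤ 1/3. Then h_p(a) is the sum of θ^(x₁+⋯+xₖ) over all nonempty factors of the word
δ(a) (`hp_eq_windowSum`), so the task is to minimize `windowSum` over words of positive letters with
length r-1 and sum s-1.

Reversing the factor m of a word u m v changes this sum by a product of two differences
(`windowSum_sub_reverse_middle`): one compares u, read backwards from the cut, with v; the other
compares m with its reverse. Since θ ≤ 1/3, the sign of each is decided by the first letter at which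
the two words differ (`prefixSum_cons_lt_cons`). Minimality therefore excludes every pattern in
which the two signs agree.

Moving a unit from a letter to one smaller by at least 2 lowers the sum, so the letters are Q = [q]
and Q + 1, the latter occurring g times (`IsMinWord.le_add_one`). Reversals then show that the runs
between occurrences of the rarer letter also differ in length by at most one
(`IsMinWord.run_le_of_sep_gt`, `IsMinWord.run_le_of_sep_lt`). When Q + 1 prevails, another reversal
puts Q at both ends (`IsMinWord.exists_eq_cons_render`). A list with entries within one of each
other is fixed up to order by its length and sum (`List.balanced`). This yields the counts of
letters and blocks, and equal runs in the divisible cases. -/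

/-! ### Prefix and factor sums of words. -/

/-- The sum of `θ ^ (x₁ + ⋯ + xₖ)` over the nonempty prefixes `x₁, …, xₖ` of a word. -/
def prefixSum (θ : ℝ) : List ℕ → ℝ
  | [] => 0
  | x :: l => θ ^ x * (1 + prefixSum θ l)

/-- The sum of `θ ^ (x₁ + ⋯ + xₖ)` over the nonempty factors `x₁, …, xₖ` of a word. -/
def windowSum (θ : ℝ) : List ℕ → ℝ
  | [] => 0
  | x :: l => windowSum θ l + prefixSum θ (x :: l)

@[simp] theorem prefixSum_nil (θ : ℝ) : prefixSum θ [] = 0 := rfl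

theorem prefixSum_cons (θ : ℝ) (x : ℕ) (l : List ℕ) :
    prefixSum θ (x :: l) = θ ^ x * (1 + prefixSum θ l) := rfl

@[simp] theorem windowSum_nil (θ : ℝ) : windowSum θ [] = 0 := rfl

theorem windowSum_cons (θ : ℝ) (x : ℕ) (l : List ℕ) :
    windowSum θ (x :: l) = windowSum θ l + θ ^ x * (1 + prefixSum θ l) := rfl

theorem prefixSum_append (θ : ℝ) (l m : List ℕ) :
    prefixSum θ (l ++ m) = prefixSum θ l + θ ^ l.sum * prefixSum θ m := by
  induction l with
  | nil => simp
  | cons x l ih => simp only [List.cons_append, prefixSum_cons, ih, List.sum_cons, pow_add]; ring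

theorem windowSum_append (θ : ℝ) (l m : List ℕ) :
    windowSum θ (l ++ m) =
      windowSum θ l + windowSum θ m + prefixSum θ l.reverse * prefixSum θ m := by
  induction l with
  | nil => simp
  | cons x l ih =>
    simp only [List.cons_append, windowSum_cons, ih, List.reverse_cons, prefixSum_append,
      prefixSum_cons, List.sum_reverse, prefixSum_nil]
    ring

theorem windowSum_reverse (θ : ℝ) (l : List ℕ) : windowSum θ l.reverse = windowSum θ l := by
  induction l with
  | nil => rfl
  | cons x l ih =>
    simp only [List.reverse_cons, windowSum_append, ih, windowSum_cons, prefixSum_cons,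
      List.reverse_reverse, windowSum_nil, prefixSum_nil]
    ring

/-- Factors inside `u`, `m` or `v`, and those running from `u` into `v`, have the same total before
and after the reversal. Only factors with one end in `m` and the other in `u` or `v` matter; they
contribute P(uᴿ)P(m) + P(mᴿ)P(v). -/
theorem windowSum_sub_reverse_middle (θ : ℝ) (u m v : List ℕ) :
    windowSum θ (u ++ m ++ v) - windowSum θ (u ++ m.reverse ++ v) =
      (prefixSum θ u.reverse - prefixSum θ v) * (prefixSum θ m - prefixSum θ m.reverse) := by
  simp only [windowSum_append, List.reverse_append, prefixSum_append, List.reverse_reverse,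
    windowSum_reverse, List.sum_reverse]
  ring

theorem prefixSum_nonneg {θ : ℝ} (h0 : 0 < θ) (l : List ℕ) : 0 ≤ prefixSum θ l := by
  induction l with
  | nil => simp
  | cons x l ih => rw [prefixSum_cons]; positivity

/-- The bound is the geometric series 1/3 + 1/9 + ⋯ = 1/2. -/
theorem prefixSum_lt_half {θ : ℝ} (h0 : 0 < θ) (h3 : θ ≤ 1 / 3) {l : List ℕ}
    (hl : ∀ x ∈ l, 1 ≤ x) : prefixSum θ l < 1 / 2 := by
  induction l with
  | nil => simp
  | cons x l ih =>
    have h1 := ih fun y hy => hl y (List.mem_cons_of_mem _ hy)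
    have h2 : θ ^ x ≤ 1 / 3 := by
      calc θ ^ x ≤ θ ^ 1 := pow_le_pow_of_le_one h0.le (by linarith) (hl x (by simp))
        _ ≤ 1 / 3 := by simpa using h3
    have h4 : 0 < θ ^ x := by positivity
    rw [prefixSum_cons]
    nlinarith

theorem prefixSum_cons_pos {θ : ℝ} (h0 : 0 < θ) (x : ℕ) (l : List ℕ) :
    0 < prefixSum θ (x :: l) := by
  have := prefixSum_nonneg h0 l
  rw [prefixSum_cons]; positivity

/-- The larger first letter gives less than θ^x · (1/3) · (3/2) = θ^x / 2, while the smaller one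
alone gives θ^x; the tails are irrelevant. -/
theorem prefixSum_cons_lt_cons {θ : ℝ} (h0 : 0 < θ) (h3 : θ ≤ 1 / 3) {x y : ℕ} (hxy : x < y)
    (l : List ℕ) {m : List ℕ} (hm : ∀ z ∈ m, 1 ≤ z) :
    prefixSum θ (y :: m) < prefixSum θ (x :: l) := by
  have h1 := prefixSum_lt_half h0 h3 hm
  have h1' := prefixSum_nonneg h0 m
  have h2 := prefixSum_nonneg h0 l
  have h4 : 0 < θ ^ x := by positivity
  have h5 : θ ^ y ≤ θ ^ x * (1 / 3) := by
    calc θ ^ y ≤ θ ^ (x + 1) := pow_le_pow_of_le_one h0.le (by linarith) hxy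
      _ = θ ^ x * θ := pow_succ _ _
      _ ≤ _ := by gcongr
  rw [prefixSum_cons, prefixSum_cons]
  nlinarith

theorem prefixSum_append_lt_append {θ : ℝ} (h0 : 0 < θ) (t : List ℕ) {l m : List ℕ}
    (h : prefixSum θ l < prefixSum θ m) : prefixSum θ (t ++ l) < prefixSum θ (t ++ m) := by
  rw [prefixSum_append, prefixSum_append]
  have : 0 < θ ^ t.sum := by positivity
  nlinarith

/-! ### Minimal words: reversals, and letters differing by at most one. -/

/-- `d` minimizes the window sum among the words of positive letters of its length and sum. -/
structure IsMinWord (θ : ℝ) (d : List ℕ) : Prop where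
  pos : ∀ x ∈ d, 1 ≤ x
  le : ∀ d' : List ℕ, (∀ x ∈ d', 1 ≤ x) → d'.length = d.length → d'.sum = d.sum →
    windowSum θ d ≤ windowSum θ d'

namespace IsMinWord

variable {θ : ℝ} {d : List ℕ}

theorem reverse (h : IsMinWord θ d) : IsMinWord θ d.reverse where
  pos x hx := h.pos x (by simpa using hx)
  le d' h1 h2 h3 := by
    rw [windowSum_reverse]
    exact h.le d' h1 (by simpa using h2) (by simpa using h3)

theorem mul_nonpos (h : IsMinWord θ d) {u m v : List ℕ} (hd : d = u ++ m ++ v) :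
    (prefixSum θ u.reverse - prefixSum θ v) * (prefixSum θ m - prefixSum θ m.reverse) ≤ 0 := by
  rw [← windowSum_sub_reverse_middle, ← hd, sub_nonpos]
  refine h.le _ (fun x hx => h.pos x ?_) ?_ ?_
  · simpa [hd] using hx
  · simp [hd]
  · simp [hd]

/-- Reversing the segment `t x … y t⁻¹` with `x < y` cannot decrease the window sum. -/
theorem prefixSum_le_of_lt (h : IsMinWord θ d) (h0 : 0 < θ) (h3 : θ ≤ 1 / 3)
    {u t m v : List ℕ} {x y : ℕ} (hxy : x < y)
    (hd : d = u ++ (t ++ x :: (m ++ y :: t.reverse)) ++ v) :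
    prefixSum θ u.reverse ≤ prefixSum θ v := by
  have h1 := h.mul_nonpos hd
  -- The segment and its reverse both begin with `t`, so the comparison is decided by `x` against
  -- `y`.
  have h2 : prefixSum θ (t ++ x :: (m ++ y :: t.reverse)).reverse <
      prefixSum θ (t ++ x :: (m ++ y :: t.reverse)) := by
    have : (t ++ x :: (m ++ y :: t.reverse)).reverse
        = t ++ y :: (m.reverse ++ x :: t.reverse) := by simp
    rw [this]
    refine prefixSum_append_lt_append h0 t (prefixSum_cons_lt_cons h0 h3 hxy _ ?_)
    intro z hz
    refine h.pos z ?_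
    simp only [List.mem_append, List.mem_cons, List.mem_reverse] at hz
    simp only [hd, List.mem_append, List.mem_cons, List.mem_reverse]
    tauto
  by_contra! h5
  nlinarith [mul_pos (sub_pos.2 h5) (sub_pos.2 h2)]

theorem prefixSum_ge_of_gt (h : IsMinWord θ d) (h0 : 0 < θ) (h3 : θ ≤ 1 / 3)
    {u t m v : List ℕ} {x y : ℕ} (hxy : y < x)
    (hd : d = u ++ (t ++ x :: (m ++ y :: t.reverse)) ++ v) :
    prefixSum θ v ≤ prefixSum θ u.reverse := by
  have := h.reverse.prefixSum_le_of_lt h0 h3 (u := v.reverse) (t := t) (m := m.reverse)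
    (v := u.reverse) hxy (by simp [hd])
  simpa using this

/-- Moving one unit from `y` to `x` affects only factors containing exactly one of the two letters.
It lowers the sum by (1 - θ) times θ^x (1+U)(1+M) - θ^(y-1) (1+M')(1+V), which is positive once y ≥
x + 2. -/
theorem le_add_one_of_append (h : IsMinWord θ d) (h0 : 0 < θ) (h3 : θ ≤ 1 / 3)
    {u m v : List ℕ} {x y : ℕ} (hd : d = u ++ x :: (m ++ y :: v)) : y ≤ x + 1 := by
  by_contra! hxy
  have hpos : ∀ z, z ∈ u ∨ z ∈ m ∨ z ∈ v → 1 ≤ z := by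
    intro z hz
    refine h.pos z ?_
    simp only [hd, List.mem_append, List.mem_cons]
    tauto
  have hx : 1 ≤ x := h.pos x (by simp [hd])
  obtain ⟨y, rfl⟩ : ∃ y', y = y' + 1 := ⟨y - 1, by omega⟩
  have key := h.le (u ++ (x + 1) :: (m ++ y :: v)) (by
      intro z hz
      simp only [List.mem_append, List.mem_cons] at hz
      rcases hz with hz | rfl | hz | rfl | hz
      · exact hpos z (by tauto)
      · omega
      · exact hpos z (by tauto)
      · omega
      · exact hpos z (by tauto)) (by simp [hd]) (by simp [hd]; omega)
  have hu := prefixSum_nonneg h0 u.reverse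
  have hm := prefixSum_nonneg h0 m
  have hm' := prefixSum_nonneg h0 m.reverse
  have hv := prefixSum_nonneg h0 v
  have hm2 := prefixSum_lt_half h0 h3 (l := m.reverse) fun z hz => hpos z (by simp at hz; tauto)
  have hv2 := prefixSum_lt_half h0 h3 (l := v) fun z hz => hpos z (by tauto)
  rw [hd] at key
  simp only [windowSum_append, windowSum_cons, prefixSum_append, prefixSum_cons] at key
  set U := prefixSum θ u.reverse
  set M := prefixSum θ m
  set M' := prefixSum θ m.reverse
  set V := prefixSum θ v
  have hwx : 0 < θ ^ x := by positivity
  have hwy : 0 < θ ^ y := by positivity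
  have hle : θ ^ y ≤ θ ^ x * θ := by
    rw [← pow_succ]
    exact pow_le_pow_of_le_one h0.le (by linarith) (by omega)
  have key2 : θ ^ x * (1 - θ) * ((1 + U) * (1 + M)) ≤ θ ^ y * (1 - θ) * ((1 + M') * (1 + V)) := by
    rw [pow_succ, pow_succ] at key
    linarith
  have hA : 1 ≤ (1 + U) * (1 + M) := by nlinarith
  -- Here 9/4 = (1 + 1/2)², and the contradiction comes from (1/3) · (9/4) = 3/4 < 1.
  have hB : (1 + M') * (1 + V) ≤ 9 / 4 := by nlinarith
  have hC : θ ^ x * (1 - θ) ≤ θ ^ x * (1 - θ) * ((1 + U) * (1 + M)) :=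
    le_mul_of_one_le_right (mul_nonneg hwx.le (by linarith)) hA
  have hD : θ ^ y * (1 - θ) * ((1 + M') * (1 + V)) ≤ θ ^ x * (1 / 3) * (1 - θ) * (9 / 4) := by
    have : 0 ≤ 1 - θ := by linarith
    have : θ ^ y ≤ θ ^ x * (1 / 3) := hle.trans (by gcongr)
    gcongr
  nlinarith [mul_pos hwx (show (0 : ℝ) < 1 - θ by linarith)]

theorem le_add_one (h : IsMinWord θ d) (h0 : 0 < θ) (h3 : θ ≤ 1 / 3) :
    ∀ x ∈ d, ∀ y ∈ d, y ≤ x + 1 := by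
  intro x hx y hy
  obtain ⟨u, w, hd⟩ := List.append_of_mem hx
  rw [hd] at hy
  simp only [List.mem_append, List.mem_cons] at hy
  rcases hy with hy | rfl | hy
  · obtain ⟨u', m, rfl⟩ := List.append_of_mem hy
    exact h.reverse.le_add_one_of_append h0 h3 (u := w.reverse) (m := m.reverse)
      (v := u'.reverse) (by simp [hd])
  · omega
  · obtain ⟨m, v, rfl⟩ := List.append_of_mem hy
    exact h.le_add_one_of_append h0 h3 hd

end IsMinWord

/-! ### Balanced lists of naturals. -/

theorem List.forall_mem_le_add_one {ks : List ℕ}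
    (h : ∀ K₁ i K₂ j K₃, ks = K₁ ++ i :: (K₂ ++ j :: K₃) → j ≤ i + 1)
    (h' : ∀ K₁ i K₂ j K₃, ks.reverse = K₁ ++ i :: (K₂ ++ j :: K₃) → j ≤ i + 1) :
    ∀ x ∈ ks, ∀ y ∈ ks, y ≤ x + 1 := by
  intro x hx y hy
  obtain ⟨u, w, hd⟩ := List.append_of_mem hx
  rw [hd] at hy
  simp only [List.mem_append, List.mem_cons] at hy
  rcases hy with hy | rfl | hy
  · obtain ⟨u', m, rfl⟩ := List.append_of_mem hy
    exact h' w.reverse x m.reverse y u'.reverse (by simp [hd])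
  · omega
  · obtain ⟨m, v, rfl⟩ := List.append_of_mem hy
    exact h _ _ _ _ _ hd

theorem List.sum_eq_of_mem_or {L : List ℕ} {m : ℕ} (h : ∀ x ∈ L, x = m ∨ x = m + 1) :
    L.sum = L.length * m + L.count (m + 1) := by
  induction L with
  | nil => simp
  | cons x L ih =>
    have h1 := ih fun y hy => h y (List.mem_cons_of_mem _ hy)
    rcases h x (by simp) with rfl | rfl <;> simp [h1] <;> ring

theorem List.count_add_count_of_mem_or {α : Type*} [DecidableEq α] {L : List α} {a b : α}
    (hab : a ≠ b) (h : ∀ x ∈ L, x = a ∨ x = b) : L.count a + L.count b = L.length := by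
  induction L with
  | nil => simp
  | cons x L ih =>
    have h1 := ih fun y hy => h y (List.mem_cons_of_mem _ hy)
    rcases h x (by simp) with rfl | rfl
    · simp [hab]; omega
    · simp [hab.symm]; omega

/-- A list of naturals whose entries differ by at most one is as equidistributed as possible. -/
theorem List.balanced {L : List ℕ} (hL : L ≠ []) (h : ∀ x ∈ L, ∀ y ∈ L, y ≤ x + 1) :
    (∀ x ∈ L, x = L.sum / L.length ∨ x = L.sum / L.length + 1) ∧
      L.count (L.sum / L.length + 1) = L.sum % L.length ∧
      L.count (L.sum / L.length) = L.length - L.sum % L.length := by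
  obtain ⟨m, hm, hmin⟩ := L.toFinset.exists_min_image id (by simpa using hL)
  simp only [List.mem_toFinset, id] at hm hmin
  have hor : ∀ x ∈ L, x = m ∨ x = m + 1 := fun x hx => by
    have := hmin x hx; have := h m hm x hx; omega
  have h1 := List.sum_eq_of_mem_or hor
  have h2 := List.count_add_count_of_mem_or (by omega) hor
  -- As the minimum `m` is attained, `m + 1` occurs fewer than `L.length` times, so its count is the
  -- remainder and `m` the quotient.
  have h3 : 0 < L.count m := List.count_pos_iff.2 hm
  have h4 : L.sum / L.length = m := by
    rw [h1, Nat.mul_add_div (by omega), Nat.div_eq_of_lt (by omega)]; rfl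
  have h5 : L.sum % L.length = L.count (m + 1) := by
    rw [h1, Nat.mul_add_mod, Nat.mod_eq_of_lt (by omega)]
  rw [h4, h5]
  exact ⟨hor, rfl, by omega⟩

/-! ### Run-length encoding of two-letter words. -/

/-- The word `c^k₁ o c^k₂ o … c^kₙ o`. -/
def render (o c : ℕ) (ks : List ℕ) : List ℕ :=
  ks.flatMap fun k => List.replicate k c ++ [o]

section render

variable {o c : ℕ}

@[simp] theorem render_nil : render o c [] = [] := rfl

@[simp] theorem render_cons (k : ℕ) (ks : List ℕ) :
    render o c (k :: ks) = List.replicate k c ++ o :: render o c ks := by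
  simp [render]

@[simp] theorem render_append (ks ks' : List ℕ) :
    render o c (ks ++ ks') = render o c ks ++ render o c ks' := by
  simp [render]

/-- With a leading `o` restored, every run is enclosed by separators, so reversing the word amounts
to reversing the list of runs. -/
theorem cons_render_reverse (ks : List ℕ) :
    o :: render o c ks.reverse = (o :: render o c ks).reverse := by
  induction ks with
  | nil => simp
  | cons k ks ih =>
    rw [List.reverse_cons, render_append, ← List.cons_append, ih]
    simp

theorem render_eq_nil_or (ks : List ℕ) : render o c ks = [] ∨ ∃ w, render o c ks = w ++ [o] := by
  induction ks using List.reverseRecOn with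
  | nil => simp
  | append_singleton ks k _ =>
    right
    exact ⟨render o c ks ++ List.replicate k c, by simp⟩

/-- The appended `o` is a sentinel closing the last run; empty runs are allowed. -/
theorem exists_append_singleton_eq_render {l : List ℕ} (h : ∀ x ∈ l, x = o ∨ x = c) :
    ∃ ks, l ++ [o] = render o c ks := by
  induction l with
  | nil => exact ⟨[0], by simp⟩
  | cons x l ih =>
    obtain ⟨ks, hks⟩ := ih fun y hy => h y (List.mem_cons_of_mem _ hy)
    rcases h x (by simp) with rfl | rfl
    · exact ⟨0 :: ks, by simp [hks]⟩
    · cases ks with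
      | nil => simp at hks
      | cons k ks => exact ⟨(k + 1) :: ks, by simp [hks, List.replicate_succ]⟩

theorem count_sep_render (hoc : o ≠ c) (ks : List ℕ) : (render o c ks).count o = ks.length := by
  induction ks with
  | nil => simp
  | cons k ks ih => simp [ih, List.count_replicate, hoc.symm]

theorem count_letter_render (hoc : o ≠ c) (ks : List ℕ) : (render o c ks).count c = ks.sum := by
  induction ks with
  | nil => simp
  | cons k ks ih => simp [ih, hoc]

end render

/-! ### Balance of the runs in a minimal word. -/

namespace IsMinWord

variable {θ : ℝ} {d : List ℕ} {o c : ℕ}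

theorem reverse_append_singleton_eq_render {ks : List ℕ} (hd : d ++ [o] = render o c ks) :
    d.reverse ++ [o] = render o c ks.reverse := by
  have := cons_render_reverse (o := o) (c := c) ks
  rw [← hd] at this
  simpa using this.symm

/-- If j ≥ i + 2, split the run of length `j` as c^e, c, c^i, c and reverse the segment from the run
of length `i` up to that c^i. To its right stands `c`; to its left stands the larger `o` or nothing,
so the reversal would lower the sum. -/
theorem run_le_of_sep_gt_aux (h : IsMinWord θ d) (h0 : 0 < θ) (h3 : θ ≤ 1 / 3) (hoc : c < o)
    {K₁ K₂ K₃ : List ℕ} {i j : ℕ}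
    (hd : d ++ [o] = render o c (K₁ ++ i :: (K₂ ++ j :: K₃))) : j ≤ i + 1 := by
  by_contra! hij
  obtain ⟨e, rfl⟩ : ∃ e, j = e + 1 + i + 1 := ⟨j - i - 2, by omega⟩
  obtain ⟨v, hv⟩ : ∃ v, v ++ [o] = o :: render o c K₃ := by
    rcases render_eq_nil_or (o := o) (c := c) K₃ with h | ⟨w, h⟩
    · exact ⟨[], by simp [h]⟩
    · exact ⟨o :: w, by simp [h]⟩
  have hd' : d = render o c K₁ ++ (List.replicate i c ++ o :: ((render o c K₂ ++
      List.replicate e c) ++ c :: (List.replicate i c).reverse)) ++ c :: v := by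
    rw [← List.append_left_inj [o], hd]
    simp [List.replicate_add, hv]
  have h1 := h.prefixSum_ge_of_gt h0 h3 hoc hd'
  have h2 : prefixSum θ (render o c K₁).reverse < prefixSum θ (c :: v) := by
    rcases render_eq_nil_or (o := o) (c := c) K₁ with hK | ⟨w, hK⟩
    · rw [hK]; exact prefixSum_cons_pos h0 _ _
    · rw [hK, List.reverse_append, List.reverse_singleton, List.singleton_append]
      refine prefixSum_cons_lt_cons h0 h3 hoc _ fun z hz => h.pos z ?_
      rw [List.mem_reverse] at hz
      simp [hd', hK, hz]
  linarith

/-- In a minimal word, the runs between occurrences of the larger letter are balanced. -/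
theorem run_le_of_sep_gt (h : IsMinWord θ d) (h0 : 0 < θ) (h3 : θ ≤ 1 / 3) (hoc : c < o)
    {ks : List ℕ} (hd : d ++ [o] = render o c ks) : ∀ x ∈ ks, ∀ y ∈ ks, y ≤ x + 1 := by
  apply List.forall_mem_le_add_one
  · rintro K₁ i K₂ j K₃ rfl
    exact h.run_le_of_sep_gt_aux h0 h3 hoc hd
  · intro K₁ i K₂ j K₃ hks
    have := reverse_append_singleton_eq_render hd
    rw [hks] at this
    exact h.reverse.run_le_of_sep_gt_aux h0 h3 hoc this

/-- The same segment is reversed, with the signs exchanged. The leading `o` guarantees that a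
separator, now the smaller letter, stands to the left of the segment even when `K₁` is empty. -/
theorem run_le_of_sep_lt_aux (h : IsMinWord θ d) (h0 : 0 < θ) (h3 : θ ≤ 1 / 3) (hoc : o < c)
    {K₁ K₂ K₃ : List ℕ} {i j : ℕ}
    (hd : d = o :: render o c (K₁ ++ i :: (K₂ ++ j :: K₃))) : j ≤ i + 1 := by
  by_contra! hij
  obtain ⟨e, rfl⟩ : ∃ e, j = e + 1 + i + 1 := ⟨j - i - 2, by omega⟩
  have hd' : d = (o :: render o c K₁) ++ (List.replicate i c ++ o :: ((render o c K₂ ++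
      List.replicate e c) ++ c :: (List.replicate i c).reverse)) ++ c :: o :: render o c K₃ := by
    rw [hd]
    simp [List.replicate_add]
  have h1 := h.prefixSum_le_of_lt h0 h3 hoc hd'
  rw [← cons_render_reverse] at h1
  have h2 := prefixSum_cons_lt_cons h0 h3 hoc (render o c K₁.reverse) (m := o :: render o c K₃)
    fun z hz => h.pos z (by rw [hd']; exact List.mem_append_right _ (List.mem_cons_of_mem _ hz))
  linarith

/-- In a minimal word, the runs between occurrences of the smaller letter are balanced. -/
theorem run_le_of_sep_lt (h : IsMinWord θ d) (h0 : 0 < θ) (h3 : θ ≤ 1 / 3) (hoc : o < c)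
    {ks : List ℕ} (hd : d = o :: render o c ks) : ∀ x ∈ ks, ∀ y ∈ ks, y ≤ x + 1 := by
  apply List.forall_mem_le_add_one
  · rintro K₁ i K₂ j K₃ rfl
    exact h.run_le_of_sep_lt_aux h0 h3 hoc hd
  · intro K₁ i K₂ j K₃ hks
    refine h.reverse.run_le_of_sep_lt_aux h0 h3 hoc (K₁ := K₁) (K₂ := K₂) (K₃ := K₃) ?_
    rw [← hks, cons_render_reverse, ← hd]

/-- If the word began with the larger letter `c`, some prefix c^i c … o c^i followed by at least one
more letter could be reversed. Nothing precedes it, so its left prefix sum is 0 and the reversal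
lowers the sum. -/
theorem first_run_eq_zero (h : IsMinWord θ d) (h0 : 0 < θ) (h3 : θ ≤ 1 / 3) (hoc : o < c)
    {k j : ℕ} {ks : List ℕ} (hks : ks ≠ []) (hd : d ++ [o] = render o c (k :: j :: ks)) :
    k = 0 := by
  by_contra hk
  -- As `ks` is nonempty, the sentinel lies in its part, and the `o` after the run of length `j` is
  -- a genuine letter of `d`.
  obtain ⟨v, hv⟩ : ∃ v, v ++ [o] = render o c ks := by
    rcases render_eq_nil_or (o := o) (c := c) ks with h | ⟨w, h⟩
    · cases ks <;> simp at h hks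
    · exact ⟨w, h.symm⟩
  have hd0 : d = List.replicate k c ++ o :: (List.replicate j c ++ o :: v) := by
    rw [← List.append_left_inj [o], hd]
    simp [hv]
  -- The prefix must stop before the end of `d`: for j < k take i = j, so that `o` follows;
  -- otherwise take i = k - 1, so that a `c` of the second run is left over.
  obtain ⟨i, e, x, v', hd'⟩ : ∃ i e x v', d = [] ++ (List.replicate i c ++ c ::
      (List.replicate e c ++ o :: (List.replicate i c).reverse)) ++ x :: v' := by
    rcases Nat.lt_or_ge j k with hjk | hjk
    · obtain ⟨e, rfl⟩ : ∃ e, k = j + 1 + e := ⟨k - j - 1, by omega⟩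
      exact ⟨j, e, o, v, by simp [hd0, List.replicate_add]⟩
    · obtain ⟨i, rfl⟩ : ∃ i, k = i + 1 := ⟨k - 1, by omega⟩
      obtain ⟨e, rfl⟩ : ∃ e, j = i + 1 + e := ⟨j - i - 1, by omega⟩
      exact ⟨i, 0, c, List.replicate e c ++ o :: v, by simp [hd0, List.replicate_add]⟩
  have h1 := h.prefixSum_ge_of_gt h0 h3 hoc hd'
  have h2 := prefixSum_cons_pos h0 x v'
  simp at h1
  linarith

/-- A minimal word with at least two occurrences of the smaller letter starts and ends with it. -/
theorem exists_eq_cons_render (h : IsMinWord θ d) (h0 : 0 < θ) (h3 : θ ≤ 1 / 3) (hoc : o < c)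
    (hmem : ∀ x ∈ d, x = o ∨ x = c) (hcount : 2 ≤ d.count o) :
    ∃ ks, d = o :: render o c ks := by
  obtain ⟨ks, hks⟩ := exists_append_singleton_eq_render hmem
  have hlen : 3 ≤ ks.length := by
    rw [← count_sep_render hoc.ne ks, ← hks]
    simp; omega
  obtain ⟨k, ks, rfl⟩ := List.exists_cons_of_ne_nil (l := ks) (by rintro rfl; simp at hlen)
  obtain ⟨K, k', rfl⟩ := List.eq_nil_or_concat' ks |>.resolve_left (by rintro rfl; simp at hlen)
  have hK : K ≠ [] := by rintro rfl; simp at hlen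
  have hk : k = 0 := by
    obtain ⟨j, K, rfl⟩ := List.exists_cons_of_ne_nil hK
    exact h.first_run_eq_zero h0 h3 hoc (ks := K ++ [k']) (by simp) (by simpa using hks)
  have hk' : k' = 0 := by
    obtain ⟨K, j, rfl⟩ := (List.eq_nil_or_concat' K).resolve_left hK
    have := reverse_append_singleton_eq_render hks
    exact h.reverse.first_run_eq_zero h0 h3 hoc (k := k') (j := j) (ks := K.reverse ++ [k])
      (by simp) (by simpa using this)
  subst hk hk'
  exact ⟨K, by rw [← List.append_left_inj [o], hks]; simp⟩

end IsMinWord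

/-! ### Maximal runs and their number. -/

/-- A maximal run of `v` in the word `L`, at the positions `i, …, i + l - 1`. -/
def IsRun (L : List ℕ) (v i l : ℕ) : Prop :=
  1 ≤ l ∧ (∀ j, i ≤ j → j < i + l → L[j]? = some v) ∧
    (∀ j, j + 1 = i → L[j]? ≠ some v) ∧ L[i + l]? ≠ some v

section IsRun

variable {o c i l : ℕ} {L : List ℕ}

/-- A run of `c` is stopped equally by another letter and by the end of the list, where `L[j]?` is
`none`, so the sentinel is harmless. -/
theorem isRun_append_singleton (hoc : o ≠ c) : IsRun (L ++ [o]) c i l ↔ IsRun L c i l := by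
  have : ∀ j : ℕ, (L ++ [o])[j]? = some c ↔ L[j]? = some c := by
    intro j
    rcases Nat.lt_trichotomy j L.length with h | rfl | h
    · rw [List.getElem?_append_left h]
    · simp [hoc]
    · rw [List.getElem?_eq_none (by simp; omega), List.getElem?_eq_none (by omega)]
  simp only [IsRun, ne_eq, this]

theorem not_isRun_nil : ¬ IsRun [] c i l := by
  rintro ⟨h1, h2, -⟩
  simpa using h2 i le_rfl (by omega)

theorem isRun_cons_sep (hoc : o ≠ c) :
    IsRun (o :: L) c i l ↔ ∃ i', i = i' + 1 ∧ IsRun L c i' l := by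
  cases i with
  | zero =>
    refine ⟨fun ⟨h1, h2, _⟩ => ?_, fun ⟨i', h, _⟩ => by omega⟩
    exact absurd (by simpa using h2 0 le_rfl (by omega)) hoc
  | succ i =>
    have key : IsRun (o :: L) c (i + 1) l ↔ IsRun L c i l := by
      have e : i + 1 + l = i + l + 1 := by omega
      constructor
      · rintro ⟨h1, h2, h3, h4⟩
        refine ⟨h1, fun j hj hj' => ?_, fun j hj => ?_, ?_⟩
        · simpa using h2 (j + 1) (by omega) (by omega)
        · simpa using h3 (j + 1) (by omega)
        · rw [e] at h4; simpa using h4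
      · rintro ⟨h1, h2, h3, h4⟩
        refine ⟨h1, fun j hj hj' => ?_, fun j hj => ?_, ?_⟩
        · cases j with
          | zero => omega
          | succ j => simpa using h2 j (by omega) (by omega)
        · cases j with
          | zero => simpa using hoc
          | succ j => simpa using h3 j (by omega)
        · rw [e]; simpa using h4
    rw [key]
    exact ⟨fun h => ⟨i, rfl, h⟩, by rintro ⟨i', h, h'⟩; obtain rfl : i = i' := by omega
                                    exact h'⟩

theorem isRun_replicate_append_sep (hoc : o ≠ c) {k : ℕ} (hk : 1 ≤ k) :
    IsRun (List.replicate k c ++ o :: L) c i l ↔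
      (i = 0 ∧ l = k) ∨ ∃ i', i = i' + (k + 1) ∧ IsRun L c i' l := by
  have hlt : ∀ j, j < k → (List.replicate k c ++ o :: L)[j]? = some c := by
    intro j hj
    rw [List.getElem?_append_left (by simpa using hj)]
    simp [hj]
  have hmid : (List.replicate k c ++ o :: L)[k]? = some o := by
    rw [List.getElem?_append_right (by simp)]; simp
  have hgt : ∀ j, (List.replicate k c ++ o :: L)[j + (k + 1)]? = L[j]? := by
    intro j
    rw [List.getElem?_append_right (by simp; omega)]
    simp [show j + (k + 1) - k = j + 1 by omega]
  have hmid' : (List.replicate k c ++ o :: L)[k]? ≠ some c := by simpa [hmid] using hoc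
  constructor
  · rintro ⟨h1, h2, h3, h4⟩
    have hik : i ≠ k := by rintro rfl; exact hmid' (h2 i le_rfl (by omega))
    rcases Nat.lt_or_ge i k with hi | hi
    · left
      have hi0 : i = 0 := by
        by_contra h
        exact h3 (i - 1) (by omega) (hlt _ (by omega))
      subst hi0
      refine ⟨rfl, ?_⟩
      rcases Nat.lt_trichotomy l k with h | h | h
      · exact absurd (hlt _ (by omega)) h4
      · exact h
      · exact absurd (h2 k (by omega) (by omega)) hmid'
    · right
      obtain ⟨i', rfl⟩ : ∃ i', i = i' + (k + 1) := ⟨i - (k + 1), by omega⟩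
      refine ⟨i', rfl, h1, fun j hj hj' => ?_, fun j hj => ?_, ?_⟩
      · rw [← hgt]; exact h2 _ (by omega) (by omega)
      · rw [← hgt]; exact h3 _ (by omega)
      · rw [← hgt, show i' + l + (k + 1) = i' + (k + 1) + l by omega]; exact h4
  · rintro (⟨rfl, rfl⟩ | ⟨i', rfl, h1, h2, h3, h4⟩)
    · exact ⟨hk, fun j _ hj => hlt j (by omega), fun j hj => by omega, by simpa using hmid'⟩
    · refine ⟨h1, fun j hj hj' => ?_, fun j hj => ?_, ?_⟩
      · obtain ⟨j', rfl⟩ : ∃ j', j = j' + (k + 1) := ⟨j - (k + 1), by omega⟩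
        rw [hgt]; exact h2 _ (by omega) (by omega)
      · rcases Nat.eq_or_lt_of_le (show k ≤ j by omega) with rfl | h
        · exact hmid'
        · obtain ⟨j', rfl⟩ : ∃ j', j = j' + (k + 1) := ⟨j - (k + 1), by omega⟩
          rw [hgt]; exact h3 _ (by omega)
      · rw [show i' + (k + 1) + l = i' + l + (k + 1) by omega, hgt]; exact h4

/-- Each positive entry of `ks` contributes exactly one run. Finiteness is carried through the
induction because the `ncard` step needs it. -/
theorem setOf_isRun_finite_and_ncard (hoc : o ≠ c) {ks : List ℕ} (hks : ∀ k ∈ ks, 1 ≤ k) (l : ℕ) :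
    {i | IsRun (render o c ks) c i l}.Finite ∧
      {i | IsRun (render o c ks) c i l}.ncard = ks.count l := by
  induction ks with
  | nil => simp [not_isRun_nil]
  | cons k ks ih =>
    obtain ⟨hfin, hcard⟩ := ih fun x hx => hks x (List.mem_cons_of_mem _ hx)
    have hset : {i | IsRun (render o c (k :: ks)) c i l} =
        {i | i = 0 ∧ l = k} ∪ (· + (k + 1)) '' {i | IsRun (render o c ks) c i l} := by
      ext i
      simp only [Set.mem_ofPred_eq, render_cons, isRun_replicate_append_sep hoc (hks k (by simp)),
        Set.mem_union, Set.mem_image]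
      refine or_congr Iff.rfl (exists_congr fun i' => ?_)
      rw [eq_comm, and_comm]
    have hfin' := hfin.image (· + (k + 1))
    have hcard' : ((· + (k + 1)) '' {i | IsRun (render o c ks) c i l}).ncard = ks.count l := by
      rw [Set.ncard_image_of_injective _ (add_left_injective _), hcard]
    rw [hset]
    by_cases hlk : l = k
    · subst hlk
      have h0 : {i : ℕ | i = 0 ∧ l = l} = {0} := by ext; simp
      rw [h0]
      refine ⟨(Set.finite_singleton 0).union hfin', ?_⟩
      rw [Set.singleton_union, Set.ncard_insert_of_notMem (by simp) hfin', hcard']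
      simp
    · have h0 : {i : ℕ | i = 0 ∧ l = k} = ∅ := by ext; simp [hlk]
      rw [h0, Set.empty_union]
      refine ⟨hfin', ?_⟩
      rw [hcard', List.count_cons_of_ne (Ne.symm hlk)]

theorem ncard_isRun_render (hoc : o ≠ c) {ks : List ℕ} (hks : ∀ k ∈ ks, 1 ≤ k) (l : ℕ) :
    {i | IsRun (render o c ks) c i l}.ncard = ks.count l :=
  (setOf_isRun_finite_and_ncard hoc hks l).2

theorem IsRun.mem_of_render (hoc : o ≠ c) {ks : List ℕ} (hks : ∀ k ∈ ks, 1 ≤ k)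
    (h : IsRun (render o c ks) c i l) : l ∈ ks := by
  rw [← List.count_pos_iff, ← ncard_isRun_render hoc hks,
    Set.ncard_pos (setOf_isRun_finite_and_ncard hoc hks l).1]
  exact ⟨i, h⟩

end IsRun

section render

variable {o c : ℕ}

theorem isChain_replicate_append (hoc : o ≠ c) (k : ℕ) {L : List ℕ}
    (h : L.IsChain fun x y => ¬(x = o ∧ y = o)) :
    (List.replicate k c ++ L).IsChain fun x y => ¬(x = o ∧ y = o) := by
  induction k with
  | zero => simpa using h
  | succ k ih =>
    rw [List.replicate_succ, List.cons_append, List.isChain_cons]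
    exact ⟨fun y _ h' => hoc h'.1.symm, ih⟩

theorem isChain_cons_render (hoc : o ≠ c) {ks : List ℕ} (hks : ∀ k ∈ ks, 1 ≤ k) :
    (o :: render o c ks).IsChain fun x y => ¬(x = o ∧ y = o) := by
  induction ks with
  | nil => simp
  | cons k ks ih =>
    obtain ⟨k, rfl⟩ : ∃ k', k = k' + 1 := ⟨k - 1, by have := hks k (by simp); omega⟩
    rw [render_cons, List.isChain_cons]
    refine ⟨?_, isChain_replicate_append hoc _ (ih fun x hx => hks x (List.mem_cons_of_mem _ hx))⟩
    simp [List.replicate_succ, hoc.symm]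

theorem getElem?_render_replicate (N t : ℕ) {j : ℕ} (hj : j < N * (t + 1)) :
    (render o c (List.replicate N t))[j]? = some (if j % (t + 1) = t then o else c) := by
  induction N generalizing j with
  | zero => omega
  | succ N ih =>
    rw [List.replicate_succ, render_cons]
    rcases Nat.lt_trichotomy j t with h | rfl | h
    · rw [List.getElem?_append_left (by simpa using h), Nat.mod_eq_of_lt (by omega)]
      simp [h, h.ne]
    · rw [List.getElem?_append_right (by simp), Nat.mod_eq_of_lt (by omega)]
      simp
    · obtain ⟨j, rfl⟩ : ∃ j', j = j' + (t + 1) := ⟨j - (t + 1), by omega⟩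
      rw [List.getElem?_append_right (by simp; omega)]
      simp only [List.length_replicate, show j + (t + 1) - t = j + 1 by omega,
        List.getElem?_cons_succ, Nat.add_mod_right]
      exact ih (by rw [Nat.succ_mul] at hj; omega)

end render

theorem List.eq_replicate_of_balanced {L : List ℕ} (hL : L ≠ [])
    (h : ∀ x ∈ L, ∀ y ∈ L, y ≤ x + 1) (hdvd : L.length ∣ L.sum) :
    L = List.replicate L.length (L.sum / L.length) := by
  obtain ⟨h1, h2, -⟩ := List.balanced hL h
  rw [Nat.mod_eq_zero_of_dvd hdvd] at h2
  refine List.eq_replicate_iff.2 ⟨rfl, fun x hx => (h1 x hx).resolve_right ?_⟩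
  rintro rfl
  exact List.count_eq_zero.1 h2 hx

/-- The mean is at least 1, and balanced entries are not below its integer part. -/
theorem List.one_le_of_balanced {L : List ℕ} (h : ∀ x ∈ L, ∀ y ∈ L, y ≤ x + 1)
    (hsum : L.length ≤ L.sum) : ∀ x ∈ L, 1 ≤ x := by
  intro x hx
  have hL : L ≠ [] := List.ne_nil_of_mem hx
  have h1 := Nat.div_pos hsum (List.length_pos_iff.2 hL)
  have := (List.balanced hL h).1 x hx
  omega

/-! ### Run structure of minimal words in the two regimes of g. -/

namespace IsMinWord

variable {θ : ℝ} {d : List ℕ}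

/-- Runs of the larger letter in a minimal word in which the larger letter prevails. -/
theorem exists_runs_of_le (h : IsMinWord θ d) (h0 : 0 < θ) (h3 : θ ≤ 1 / 3) {Q g : ℕ}
    (hQ : d.sum / d.length = Q) (hg : d.sum % d.length = g) (hgd : g + 2 ≤ d.length)
    (hle : d.length ≤ 2 * g) :
    ∃ ks, d = Q :: render Q (Q + 1) ks ∧ ks.length = d.length - g - 1 ∧ ks.sum = g ∧
      (∀ k ∈ ks, 1 ≤ k) ∧ ∀ x ∈ ks, ∀ y ∈ ks, y ≤ x + 1 := by
  have hd : d ≠ [] := by rintro rfl; simp at hgd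
  obtain ⟨b1, b2, b3⟩ := List.balanced hd (h.le_add_one h0 h3)
  rw [hQ, hg] at b2 b3
  rw [hQ] at b1
  -- `hgd` leaves at least two letters `Q`.
  obtain ⟨ks, hks⟩ := h.exists_eq_cons_render h0 h3 (Nat.lt_succ_self Q) b1 (by omega)
  have hlen : ks.length = d.length - g - 1 := by
    have := count_sep_render (Nat.lt_succ_self Q).ne ks
    rw [hks, List.count_cons_self] at b3
    rw [← hks] at b3
    simp only [Nat.succ_eq_add_one] at *
    omega
  have hsum : ks.sum = g := by
    have := count_letter_render (Nat.lt_succ_self Q).ne ks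
    rw [hks, List.count_cons_of_ne (Nat.lt_succ_self Q).ne] at b2
    simp only [Nat.succ_eq_add_one] at *
    omega
  have hbal := h.run_le_of_sep_lt h0 h3 (Nat.lt_succ_self Q) hks
  exact ⟨ks, hks, hlen, hsum, List.one_le_of_balanced hbal (by omega), hbal⟩

/-- Runs of the smaller letter in a minimal word in which the smaller letter prevails. -/
theorem exists_runs_of_lt (h : IsMinWord θ d) (h0 : 0 < θ) (h3 : θ ≤ 1 / 3) {Q g : ℕ}
    (hQ : d.sum / d.length = Q) (hg : d.sum % d.length = g) (hlt : 2 * g < d.length) :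
    ∃ ks, d ++ [Q + 1] = render (Q + 1) Q ks ∧ ks.length = g + 1 ∧ ks.sum = d.length - g ∧
      (∀ k ∈ ks, 1 ≤ k) ∧ ∀ x ∈ ks, ∀ y ∈ ks, y ≤ x + 1 := by
  have hd : d ≠ [] := by rintro rfl; simp at hlt
  obtain ⟨b1, b2, b3⟩ := List.balanced hd (h.le_add_one h0 h3)
  rw [hQ, hg] at b2 b3
  rw [hQ] at b1
  have hne : Q + 1 ≠ Q := by omega
  obtain ⟨ks, hks⟩ := exists_append_singleton_eq_render fun x hx => (b1 x hx).symm
  have hlen : ks.length = g + 1 := by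
    rw [← count_sep_render hne ks, ← hks]
    simp [b2]
  have hsum : ks.sum = d.length - g := by
    rw [← count_letter_render hne ks, ← hks]
    simp [b3]
  have hbal := h.run_le_of_sep_gt h0 h3 (Nat.lt_succ_self Q) hks
  exact ⟨ks, hks, hlen, hsum, List.one_le_of_balanced hbal (by omega), hbal⟩

end IsMinWord

/-! ### Blocks of vectors as runs of lists. -/

section ofFn

variable {n : ℕ} (f : Fin n → ℕ)

theorem getElem?_ofFn_eq_some {j v : ℕ} :
    (List.ofFn f)[j]? = some v ↔ ∃ hj : j < n, f ⟨j, hj⟩ = v := by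
  simp

theorem isBlock_iff_isRun (v i l : ℕ) :
    IsBlock (fun j => (f j : ℤ)) (v : ℤ) i l ↔ IsRun (List.ofFn f) v i l := by
  simp only [IsBlock, IsRun, ne_eq, getElem?_ofFn_eq_some, Nat.cast_inj]
  constructor
  · rintro ⟨h1, h2, h3, h4, h5⟩
    exact ⟨h1, fun j hj hj' => ⟨by omega, h3 _ hj hj'⟩, fun j hj ⟨hj', hf⟩ => h4 _ hj hf,
      fun ⟨hj', hf⟩ => h5 _ rfl hf⟩
  · rintro ⟨h1, h2, h3, h4⟩
    refine ⟨h1, ?_, fun j hj hj' => (h2 j hj hj').2, fun j hj hf => h3 j hj ⟨j.2, hf⟩,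
      fun j hj hf => h4 ⟨hj ▸ j.2, ?_⟩⟩
    · have := (h2 (i + l - 1) (by omega) (by omega)).1
      omega
    · rw [← hf]; congr; exact hj.symm

theorem numBlocks_eq_ncard_isRun (v l : ℕ) :
    numBlocks (fun j => (f j : ℤ)) (v : ℤ) l = {i | IsRun (List.ofFn f) v i l}.ncard := by
  simp only [numBlocks, isBlock_iff_isRun]

theorem numEntries_eq_count (v : ℕ) :
    numEntries (fun j => (f j : ℤ)) (v : ℤ) = (List.ofFn f).count v := by
  simp only [numEntries, Nat.cast_inj]
  induction n with
  | zero => simp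
  | succ n ih =>
    rw [Fin.card_filter_univ_succ, List.ofFn_succ, List.count_cons, ih]
    simp only [beq_iff_eq]
    split_ifs <;> omega

end ofFn

/-! ### From tuples to words. -/

section tuple

theorem deltaInv_delta {r : ℕ} {a : Fin r → ℤ} (h0 : ∀ i : Fin r, (i : ℕ) = 0 → a i = 0) :
    deltaInv (delta a) = a := by
  cases r with
  | zero => ext i; exact i.elim0
  | succ m =>
    ext i
    induction i using Fin.induction with
    | zero => simp [deltaInv, h0 0 rfl]
    | succ i ih =>
      have : deltaInv (delta a) i.succ = deltaInv (delta a) i.castSucc + delta a i := by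
        simp only [deltaInv, Fin.val_succ, Fin.val_castSucc]
        rw [← Finset.sum_filter, ← Finset.sum_filter]
        have hs : (Finset.univ.filter fun j : Fin (m + 1 - 1) => (j : ℕ) < (i : ℕ) + 1) =
            insert i (Finset.univ.filter fun j : Fin (m + 1 - 1) => (j : ℕ) < (i : ℕ)) := by
          ext j
          simp only [Finset.mem_filter, Finset.mem_univ, true_and, Finset.mem_insert, Fin.ext_iff]
          omega
        rw [hs, Finset.sum_insert (by simp), add_comm]
      rw [this, ih]
      simp only [delta]
      change a i.castSucc + (a i.succ - a i.castSucc) = a i.succ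
      ring

theorem sum_one_div_rpow_eq_prefixSum (p : ℕ) (hp : 0 < p) {m : ℕ} (a : Fin (m + 1) → ℤ)
    (f : Fin m → ℕ) (hf : ∀ j : Fin m, a j.succ - a j.castSucc = f j) :
    ∑ i : Fin m, 1 / (p : ℝ) ^ ((a i.succ : ℝ) - a 0) = prefixSum (1 / p) (List.ofFn f) := by
  have hp' : (0 : ℝ) < p := by exact_mod_cast hp
  induction m with
  | zero => simp
  | succ m ih =>
    have h0 : ((a 1 : ℤ) : ℝ) - a 0 = (f 0 : ℕ) := by
      have := hf 0
      rw [Fin.succ_zero_eq_one, Fin.castSucc_zero] at this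
      exact_mod_cast this
    have ih' := ih (fun i => a i.succ) (fun j => f j.succ) fun j => hf j.succ
    rw [Fin.sum_univ_succ, List.ofFn_succ, prefixSum_cons, ← ih', mul_add, Finset.mul_sum, mul_one]
    congr 1
    · rw [Fin.succ_zero_eq_one, h0, Real.rpow_natCast, one_div_pow]
    · refine Finset.sum_congr rfl fun i _ => ?_
      have : ((a i.succ.succ : ℤ) : ℝ) - a 0 = (f 0 : ℕ) + ((a i.succ.succ : ℝ) - a 1) := by
        rw [← h0]; ring
      rw [this, Real.rpow_add hp', Real.rpow_natCast, one_div_pow, one_div_mul_one_div,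
        Fin.succ_zero_eq_one]

/-- Pairs involving the first index give the prefix sum; the others form the same sum for the tail
of the word. -/
theorem hp_eq_windowSum_of_succ (p : ℕ) (hp0 : 0 < p) {m : ℕ} (a : Fin (m + 1) → ℤ)
    (f : Fin m → ℕ) (hf : ∀ j : Fin m, a j.succ - a j.castSucc = f j) :
    hp p (fun i => (a i : ℝ)) = windowSum (1 / p) (List.ofFn f) := by
  induction m with
  | zero => simp [hp]
  | succ m ih =>
    have ih' := ih (fun i => a i.succ) (fun j => f j.succ) fun j => hf j.succ
    have h1 := sum_one_div_rpow_eq_prefixSum p hp0 a f hf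
    rw [List.ofFn_succ, windowSum, ← ih', ← List.ofFn_succ, ← h1]
    simp only [hp]
    rw [Fin.sum_univ_succ, Fin.sum_Ioi_zero, add_comm]
    simp only [Fin.sum_Ioi_succ]

theorem hp_eq_windowSum (p : ℕ) (hp0 : 0 < p) {r : ℕ} (a : Fin r → ℤ) (f : Fin (r - 1) → ℕ)
    (hf : ∀ j, delta a j = f j) :
    hp p (fun i => (a i : ℝ)) = windowSum (1 / p) (List.ofFn f) := by
  cases r with
  | zero => simp [hp]
  | succ m => exact hp_eq_windowSum_of_succ p hp0 a f hf

/-- The tuple of partial sums of a word of positive letters is admissible. -/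
theorem partialSums_mem_admissible {s r : ℕ} (hr : 1 ≤ r) (hs : 1 ≤ s) {d : List ℕ}
    (hpos : ∀ x ∈ d, 1 ≤ x) (hlen : d.length = r - 1) (hsum : d.sum = s - 1) :
    (fun i : Fin r => ((d.take i).sum : ℤ)) ∈ admissible s r := by
  obtain ⟨m, rfl⟩ : ∃ m, r = m + 1 := ⟨r - 1, by omega⟩
  refine ⟨Fin.strictMono_iff_lt_succ.2 fun i => ?_, fun i hi => by simp [hi], fun i hi => ?_⟩
  · have hi : (i : ℕ) < d.length := by omega
    have := hpos _ (List.getElem_mem hi)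
    simp only [Fin.val_succ, Fin.val_castSucc]
    rw [List.sum_take_succ _ _ hi]
    push_cast
    omega
  · beta_reduce
    rw [List.take_of_length_le (by omega), hsum]
    omega

theorem IsMinimizer.exists_isMinWord {p s r : ℕ} {a : Fin r → ℤ} (h : IsMinimizer p s r a)
    (hp0 : 0 < p) (hr : 2 ≤ r) (hs : 1 ≤ s) :
    ∃ f : Fin (r - 1) → ℕ, delta a = (fun j => (f j : ℤ)) ∧ (List.ofFn f).sum = s - 1 ∧
      IsMinWord (1 / p) (List.ofFn f) := by
  obtain ⟨⟨hmono, hz, hlast⟩, hmin⟩ := h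
  have hpos : ∀ j, 1 ≤ delta a j := fun j => by
    have : a ⟨(j : ℕ), by have := j.isLt; omega⟩ < a ⟨(j : ℕ) + 1, by have := j.isLt; omega⟩ :=
      hmono (by simp [Fin.lt_def])
    simp only [delta]
    omega
  have hf : ∀ j, delta a j = ((delta a j).toNat : ℤ) := fun j => by have := hpos j; omega
  have hsum : (List.ofFn fun j => (delta a j).toNat).sum = s - 1 := by
    have h1 := congrFun (deltaInv_delta hz) ⟨r - 1, by omega⟩
    rw [hlast _ (by simp; omega)] at h1
    have h2 : deltaInv (delta a) ⟨r - 1, by omega⟩ = ∑ j, ((delta a j).toNat : ℤ) := by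
      simp only [deltaInv]
      exact Finset.sum_congr rfl fun j _ => by rw [if_pos j.isLt]; exact hf j
    rw [List.sum_ofFn]
    rw [h2, ← Nat.cast_sum] at h1
    omega
  refine ⟨fun j => (delta a j).toNat, funext hf, hsum, ?_, ?_⟩
  · intro x hx
    obtain ⟨j, rfl⟩ := (List.mem_ofFn' _ _).1 hx
    have := hpos j
    simp only
    omega
  · intro d hd hlen hdsum
    rw [List.length_ofFn] at hlen
    rw [hsum] at hdsum
    have hb := partialSums_mem_admissible (by omega) hs hd hlen hdsum
    have h1 := hmin hb
    simp only [Set.mem_ofPred_eq] at h1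
    rw [hp_eq_windowSum p hp0 a _ hf, hp_eq_windowSum p hp0 (fun i : Fin r => ((d.take i).sum : ℤ))
      (fun j => d[(j : ℕ)]) ?_] at h1
    · have hd' : List.ofFn (fun j : Fin (r - 1) => d[(j : ℕ)]) = d :=
        List.ext_getElem (by simp [hlen]) fun i _ _ => by simp
      rwa [hd'] at h1
    · intro j
      have hj : (j : ℕ) < d.length := by omega
      simp only [delta]
      rw [List.sum_take_succ _ _ hj]
      push_cast
      ring

end tuple

/-! ### Reading the delta vector off its runs. -/

theorem IsLeastPosResidue.eq_mod {m b x : ℕ} (h : IsLeastPosResidue m b x)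
    (hdvd : ¬ m ∣ b) : x = b % m := by
  have hpos : 0 < b % m := Nat.pos_of_ne_zero fun h' => hdvd (Nat.dvd_of_mod_eq_zero h')
  refine le_antisymm (h.2 ⟨hpos, Nat.mod_modEq b m⟩) ?_
  have h1 : x % m = b % m := h.1.2
  rw [← h1]
  exact Nat.mod_le _ _

section runs

variable {n : ℕ} {f : Fin n → ℕ} {o c : ℕ} {ks : List ℕ}

theorem blocks_of_balanced (hne : ks ≠ []) (hbal : ∀ x ∈ ks, ∀ y ∈ ks, y ≤ x + 1)
    (hmem : ∀ i l, IsRun (List.ofFn f) c i l → l ∈ ks)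
    (hcard : ∀ l, {i | IsRun (List.ofFn f) c i l}.ncard = ks.count l) :
    (∀ i l, IsBlock (fun j => (f j : ℤ)) (c : ℤ) i l →
      l = ks.sum / ks.length ∨ l = ks.sum / ks.length + 1) ∧
    numBlocks (fun j => (f j : ℤ)) (c : ℤ) (ks.sum / ks.length + 1) = ks.sum % ks.length ∧
    numBlocks (fun j => (f j : ℤ)) (c : ℤ) (ks.sum / ks.length) =
      ks.length - ks.sum % ks.length := by
  obtain ⟨b1, b2, b3⟩ := List.balanced hne hbal
  simp only [isBlock_iff_isRun, numBlocks_eq_ncard_isRun, hcard]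
  exact ⟨fun i l h => b1 l (hmem i l h), b2, b3⟩

theorem isRun_ofFn_of_eq_cons (hoc : o ≠ c) (hks : ∀ k ∈ ks, 1 ≤ k)
    (hd : List.ofFn f = o :: render o c ks) :
    (∀ i l, IsRun (List.ofFn f) c i l → l ∈ ks) ∧
      ∀ l, {i | IsRun (List.ofFn f) c i l}.ncard = ks.count l := by
  rw [hd]
  constructor
  · intro i l h
    obtain ⟨i', -, h'⟩ := (isRun_cons_sep hoc).1 h
    exact h'.mem_of_render hoc hks
  · intro l
    rw [← ncard_isRun_render hoc hks, ← Set.ncard_image_of_injective {i | IsRun (render o c ks) c i l}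
      (add_left_injective 1)]
    congr 1
    ext i
    simp only [Set.mem_ofPred_eq, isRun_cons_sep hoc, Set.mem_image]
    exact exists_congr fun i' => by rw [eq_comm, and_comm]

theorem isRun_ofFn_of_append_eq (hoc : o ≠ c) (hks : ∀ k ∈ ks, 1 ≤ k)
    (hd : List.ofFn f ++ [o] = render o c ks) :
    (∀ i l, IsRun (List.ofFn f) c i l → l ∈ ks) ∧
      ∀ l, {i | IsRun (List.ofFn f) c i l}.ncard = ks.count l := by
  simp only [← isRun_append_singleton (L := List.ofFn f) hoc, hd]
  exact ⟨fun i l h => h.mem_of_render hoc hks, ncard_isRun_render hoc hks⟩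

theorem ends_of_eq_cons (hd : List.ofFn f = o :: render o c ks) (hn : 0 < n) :
    f ⟨0, hn⟩ = o ∧ f ⟨n - 1, by omega⟩ = o := by
  constructor
  · have h : (List.ofFn f)[0]? = some o := by simp [hd]
    exact (getElem?_ofFn_eq_some f).1 h |>.2
  · have h : (List.ofFn f).reverse[0]? = some o := by
      rw [hd, ← cons_render_reverse]; simp
    rw [List.getElem?_reverse (by simpa using hn), List.length_ofFn] at h
    exact (getElem?_ofFn_eq_some f).1 h |>.2

theorem not_adjacent_of_eq_cons (hoc : o ≠ c) (hks : ∀ k ∈ ks, 1 ≤ k)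
    (hd : List.ofFn f = o :: render o c ks) (j : ℕ) (hj : j + 1 < n) :
    ¬(f ⟨j, by omega⟩ = o ∧ f ⟨j + 1, hj⟩ = o) := by
  have h := isChain_cons_render hoc hks
  rw [← hd, List.isChain_iff_getElem] at h
  have := h j (by simpa using hj)
  rwa [List.getElem_ofFn, List.getElem_ofFn] at this

/-- The separators added at both ends let one chain condition express both that no two `o` are
adjacent and that neither end is `o`. -/
theorem isChain_of_append_eq (hoc : o ≠ c) (hks : ∀ k ∈ ks, 1 ≤ k)
    (hd : List.ofFn f ++ [o] = render o c ks) :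
    (o :: (List.ofFn f ++ [o])).IsChain fun x y => ¬(x = o ∧ y = o) := by
  rw [hd]
  exact isChain_cons_render hoc hks

theorem ends_of_append_eq (hoc : o ≠ c) (hks : ∀ k ∈ ks, 1 ≤ k)
    (hd : List.ofFn f ++ [o] = render o c ks) (hn : 0 < n) :
    f ⟨0, hn⟩ ≠ o ∧ f ⟨n - 1, by omega⟩ ≠ o := by
  have h := isChain_of_append_eq hoc hks hd
  obtain ⟨n, rfl⟩ : ∃ m, n = m + 1 := ⟨n - 1, by omega⟩
  constructor
  · rw [List.ofFn_succ, List.cons_append, List.isChain_cons_cons] at h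
    simpa using h.1
  · have h1 := (List.isChain_cons.1 h).2
    rw [List.isChain_append] at h1
    have h2 := h1.2.2 (f (Fin.last n)) (by rw [List.ofFn_succ_last]; simp) o (by simp)
    have h3 : f (Fin.last n) ≠ o := by simpa using h2
    exact h3

theorem not_adjacent_of_append_eq (hoc : o ≠ c) (hks : ∀ k ∈ ks, 1 ≤ k)
    (hd : List.ofFn f ++ [o] = render o c ks) (j : ℕ) (hj : j + 1 < n) :
    ¬(f ⟨j, by omega⟩ = o ∧ f ⟨j + 1, hj⟩ = o) := by
  have h := isChain_of_append_eq hoc hks hd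
  have h1 := (List.isChain_append.1 (List.isChain_cons.1 h).2).1
  rw [List.isChain_iff_getElem] at h1
  have := h1 j (by simpa using hj)
  rwa [List.getElem_ofFn, List.getElem_ofFn] at this

theorem eq_singleFirst (hne : ks ≠ []) (hbal : ∀ x ∈ ks, ∀ y ∈ ks, y ≤ x + 1)
    (hd : List.ofFn f = o :: render o c ks) (hdvd : ks.length ∣ ks.sum) :
    (fun j => (f j : ℤ)) = singleFirst n o c (ks.sum / ks.length) := by
  have hrep := List.eq_replicate_of_balanced hne hbal hdvd
  generalize ks.sum / ks.length = t at *
  generalize ks.length = N at *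
  subst hrep
  ext ⟨j, hj⟩
  have hlen := congrArg List.length hd
  have hget := (getElem?_ofFn_eq_some f).2 ⟨hj, rfl⟩
  rw [hd] at hget
  cases j with
  | zero => simp [singleFirst] at hget ⊢; exact hget.symm
  | succ j =>
    have hj' : j < N * (t + 1) := by
      simp [render] at hlen
      omega
    rw [List.getElem?_cons_succ, getElem?_render_replicate _ _ hj'] at hget
    have hmod : (j + 1) % (t + 1) = 0 ↔ j % (t + 1) = t := by
      have h1 : j % (t + 1) < t + 1 := Nat.mod_lt j (Nat.succ_pos t)
      rw [Nat.add_mod]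
      rcases Nat.eq_zero_or_pos t with rfl | ht
      · simp [Nat.mod_one]
      rw [Nat.mod_eq_of_lt (show 1 < t + 1 by omega)]
      rcases Nat.eq_or_lt_of_le (Nat.lt_succ_iff.1 h1) with h2 | h2
      · simp [h2]
      · rw [Nat.mod_eq_of_lt (by omega)]; omega
    simp only [singleFirst, hmod]
    rw [← Option.some.inj hget]
    split_ifs <;> rfl

theorem eq_groupFirst (hne : ks ≠ []) (hbal : ∀ x ∈ ks, ∀ y ∈ ks, y ≤ x + 1)
    (hd : List.ofFn f ++ [o] = render o c ks) (hdvd : ks.length ∣ ks.sum) :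
    (fun j => (f j : ℤ)) = groupFirst n c o (ks.sum / ks.length) := by
  have hrep := List.eq_replicate_of_balanced hne hbal hdvd
  generalize ks.sum / ks.length = t at *
  generalize ks.length = N at *
  subst hrep
  ext ⟨j, hj⟩
  have hlen := congrArg List.length hd
  have hget := (getElem?_ofFn_eq_some f).2 ⟨hj, rfl⟩
  have hj' : j < N * (t + 1) := by
    simp [render] at hlen
    omega
  rw [← List.getElem?_append_left (l₂ := [o]) (by simpa using hj), hd,
    getElem?_render_replicate _ _ hj'] at hget
  simp only [groupFirst]
  rw [← Option.some.inj hget]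
  split_ifs <;> rfl

end runs

/-! ### The main theorem. -/

theorem theorem2p2 (p s r g : ℕ) (q q₁ q₂ : ℚ) (a : Fin r → ℤ)
    (hp_prime : p.Prime) (hp3 : 3 ≤ p) (hr : 3 ≤ r) (hrs : r < s)
    (h1 : ¬ (r - 1) ∣ (s - 1)) (h2 : ¬ (r - 1) ∣ s)
    (hg : IsLeastPosResidue (r - 1) (s - 1) g)
    (hq : q = ((s : ℚ) - 1) / ((r : ℚ) - 1))
    (hq₁ : q₁ = ((r : ℚ) - g - 1) / ((g : ℚ) + 1))
    (hq₂ : q₂ = (g : ℚ) / ((r : ℚ) - g - 2))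
    (ha : IsMinimizer p s r a) :
    (r - 1 ≤ 2 * g →
      ((r - g - 2) ∣ g →
        a = deltaInv (singleFirst (r - 1) ⌊q⌋ ⌊q + 1⌋ ⌊q₂⌋₊)) ∧
      (¬ (r - g - 2) ∣ g →
        numEntries (delta a) ⌊q⌋ = r - g - 1 ∧
        delta a ⟨0, by omega⟩ = ⌊q⌋ ∧
        delta a ⟨r - 2, by omega⟩ = ⌊q⌋ ∧
        (∀ (j : ℕ) (hj : j + 1 < r - 1),
          ¬ (delta a ⟨j, by omega⟩ = ⌊q⌋ ∧ delta a ⟨j + 1, hj⟩ = ⌊q⌋)) ∧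
        numEntries (delta a) ⌊q + 1⌋ = g ∧
        (∀ j, delta a j ≠ ⌊q⌋ → delta a j = ⌊q + 1⌋) ∧
        (∀ i l, IsBlock (delta a) ⌊q + 1⌋ i l → l = ⌊q₂⌋₊ ∨ l = ⌊q₂ + 1⌋₊) ∧
        (∀ e, IsLeastPosResidue (r - g - 2) g e →
          numBlocks (delta a) ⌊q + 1⌋ ⌊q₂ + 1⌋₊ = e ∧
          numBlocks (delta a) ⌊q + 1⌋ ⌊q₂⌋₊ = r - g - 2 - e))) ∧
    (2 * g ≤ r - 2 →
      ((g + 1) ∣ (r - g - 1) →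
        a = deltaInv (groupFirst (r - 1) ⌊q⌋ ⌊q + 1⌋ ⌊q₁⌋₊)) ∧
      (¬ (g + 1) ∣ (r - g - 1) →
        numEntries (delta a) ⌊q + 1⌋ = g ∧
        delta a ⟨0, by omega⟩ ≠ ⌊q + 1⌋ ∧
        delta a ⟨r - 2, by omega⟩ ≠ ⌊q + 1⌋ ∧
        (∀ (j : ℕ) (hj : j + 1 < r - 1),
          ¬ (delta a ⟨j, by omega⟩ = ⌊q + 1⌋ ∧ delta a ⟨j + 1, hj⟩ = ⌊q + 1⌋)) ∧
        numEntries (delta a) ⌊q⌋ = r - g - 1 ∧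
        (∀ j, delta a j ≠ ⌊q + 1⌋ → delta a j = ⌊q⌋) ∧
        (∀ i l, IsBlock (delta a) ⌊q⌋ i l → l = ⌊q₁⌋₊ ∨ l = ⌊q₁ + 1⌋₊) ∧
        (∀ f, IsLeastPosResidue (g + 1) (r - g - 1) f →
          numBlocks (delta a) ⌊q⌋ ⌊q₁ + 1⌋₊ = f ∧
          numBlocks (delta a) ⌊q⌋ ⌊q₁⌋₊ = g + 1 - f))) := by
  have hθ0 : (0 : ℝ) < 1 / p := by have := hp_prime.pos; positivity
  have hθ3 : (1 : ℝ) / p ≤ 1 / 3 := by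
    have : (3 : ℝ) ≤ p := by exact_mod_cast hp3
    gcongr
  obtain ⟨f, hf, hsum, hmin⟩ := ha.exists_isMinWord hp_prime.pos (by omega) (by omega)
  have ha' : deltaInv (fun j => (f j : ℤ)) = a := hf ▸ deltaInv_delta ha.1.2.1
  have hlen : (List.ofFn f).length = r - 1 := List.length_ofFn
  have hgmod : g = (s - 1) % (r - 1) := hg.eq_mod h1
  -- The value g = r - 2 would make s divisible by r - 1. Hence r - g - 2 is positive and at least
  -- two entries equal [q].
  have hgr : g + 2 ≤ r - 1 := by
    have hlt : g < r - 1 := hgmod ▸ Nat.mod_lt _ (by omega)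
    by_contra! hlt'
    refine h2 ⟨(s - 1) / (r - 1) + 1, ?_⟩
    have := Nat.div_add_mod (s - 1) (r - 1)
    rw [mul_add]
    omega
  obtain ⟨Q, hQ⟩ : ∃ Q, (s - 1) / (r - 1) = Q := ⟨_, rfl⟩
  have hqf : ⌊q⌋ = (Q : ℤ) := by
    rw [hq, ← hQ, ← Nat.cast_one, ← Nat.cast_sub (by omega), ← Nat.cast_sub (by omega),
      Rat.floor_natCast_div_natCast]
    rfl
  have hqf1 : ⌊q + 1⌋ = ((Q + 1 : ℕ) : ℤ) := by rw [Int.floor_add_one, hqf]; rfl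
  have hd1 : (List.ofFn f).sum / (List.ofFn f).length = Q := by rw [hsum, hlen, hQ]
  have hd2 : (List.ofFn f).sum % (List.ofFn f).length = g := by rw [hsum, hlen, hgmod]
  obtain ⟨b1, b2, b3⟩ := List.balanced (List.length_pos_iff.1 (by omega))
    (hmin.le_add_one hθ0 hθ3)
  rw [hd1, hd2] at b2 b3
  rw [hd1] at b1
  have hent : ∀ j, f j = Q ∨ f j = Q + 1 := fun j => b1 _ ((List.mem_ofFn' _ _).2 ⟨j, rfl⟩)
  rw [hqf, hqf1, hf]
  beta_reduce
  constructor
  · intro hle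
    obtain ⟨ks, hd, hkl, hks, hk1, hbal⟩ := hmin.exists_runs_of_le hθ0 hθ3 hd1 hd2 (by omega)
      (by omega)
    have hkl' : ks.length = r - g - 2 := by omega
    have hq2f : ⌊q₂⌋₊ = ks.sum / ks.length := by
      have : ((ks.length : ℕ) : ℚ) = (r : ℚ) - g - 2 := by
        rw [hkl', Nat.sub_sub, Nat.cast_sub (by omega)]; push_cast; ring
      rw [hq₂, ← this, Nat.floor_div_eq_div, hks]
    have hq2f1 : ⌊q₂ + 1⌋₊ = ks.sum / ks.length + 1 := by
      have : (0 : ℚ) < (r : ℚ) - g - 2 := by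
        have : ((g + 3 : ℕ) : ℚ) ≤ r := by exact_mod_cast (by omega : g + 3 ≤ r)
        push_cast at this
        linarith
      rw [Nat.floor_add_one (by rw [hq₂]; positivity), hq2f]
    have hne : ks ≠ [] := List.length_pos_iff.1 (by omega)
    have hQQ : Q ≠ Q + 1 := by omega
    obtain ⟨hm1, hm2⟩ := isRun_ofFn_of_eq_cons hQQ hk1 hd
    obtain ⟨c1, c2, c3⟩ := blocks_of_balanced hne hbal hm1 hm2
    obtain ⟨e1, e2⟩ := ends_of_eq_cons hd (by omega)
    rw [hq2f, hq2f1]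
    refine ⟨fun hdvd => ?_, fun hdvd => ⟨?_, ?_, ?_, ?_, ?_, ?_, c1, ?_⟩⟩
    · rw [← ha', eq_singleFirst hne hbal hd (by rwa [hkl', hks])]
    · rw [numEntries_eq_count, b3]; omega
    · exact_mod_cast e1
    · exact_mod_cast e2
    · intro j hj
      exact_mod_cast not_adjacent_of_eq_cons hQQ hk1 hd j hj
    · rw [numEntries_eq_count, b2]
    · intro j hj
      exact_mod_cast (hent j).resolve_left (by exact_mod_cast hj)
    · intro e he
      rw [he.eq_mod hdvd]
      rw [hks, hkl'] at c2 c3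
      rw [hks, hkl']
      exact ⟨c2, c3⟩
  · intro hle
    obtain ⟨ks, hd, hkl, hks, hk1, hbal⟩ := hmin.exists_runs_of_lt hθ0 hθ3 hd1 hd2 (by omega)
    have hks' : ks.sum = r - g - 1 := by omega
    have hq1f : ⌊q₁⌋₊ = ks.sum / ks.length := by
      have h3 : ((ks.length : ℕ) : ℚ) = (g : ℚ) + 1 := by rw [hkl]; push_cast; rfl
      have h4 : ((ks.sum : ℕ) : ℚ) = (r : ℚ) - g - 1 := by
        rw [hks', Nat.sub_sub, Nat.cast_sub (by omega)]; push_cast; ring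
      rw [hq₁, ← h3, ← h4, Nat.floor_div_eq_div]
    have hq1f1 : ⌊q₁ + 1⌋₊ = ks.sum / ks.length + 1 := by
      have : (0 : ℚ) < (r : ℚ) - g - 1 := by
        have : ((g + 3 : ℕ) : ℚ) ≤ r := by exact_mod_cast (by omega : g + 3 ≤ r)
        push_cast at this
        linarith
      rw [Nat.floor_add_one (by rw [hq₁]; positivity), hq1f]
    have hne : ks ≠ [] := List.length_pos_iff.1 (by omega)
    have hQQ : Q + 1 ≠ Q := by omega
    obtain ⟨hm1, hm2⟩ := isRun_ofFn_of_append_eq hQQ hk1 hd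
    obtain ⟨c1, c2, c3⟩ := blocks_of_balanced hne hbal hm1 hm2
    obtain ⟨e1, e2⟩ := ends_of_append_eq hQQ hk1 hd (by omega)
    rw [hq1f, hq1f1]
    refine ⟨fun hdvd => ?_, fun hdvd => ⟨?_, ?_, ?_, ?_, ?_, ?_, c1, ?_⟩⟩
    · rw [← ha', eq_groupFirst hne hbal hd (by rwa [hkl, hks'])]
    · rw [numEntries_eq_count, b2]
    · exact_mod_cast e1
    · exact_mod_cast e2
    · intro j hj
      exact_mod_cast not_adjacent_of_append_eq hQQ hk1 hd j hj
    · rw [numEntries_eq_count, b3]; omega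
    · intro j hj
      exact_mod_cast (hent j).resolve_right (by exact_mod_cast hj)
    · intro e he
      rw [he.eq_mod hdvd]
      rw [hks', hkl] at c2 c3
      rw [hks', hkl]
      exact ⟨c2, c3⟩
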